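/- Let $H=L^2((0,1);\mathbb{R})$ (Lebesgue measure), let $c_0\in(0,\infty)$, $c_1\in\mathbb{R}$, let $e_n\in H$, $n\in\{1,2,3,\dots\}$, be the (class of the) function $x\mapsto\sqrt{2}\sin(n\pi x)$, and let $\mathbb{H}=\{e_n: n\ge 1\}$, an orthonormal basis of $H$. Let $A$ be the linear operator on $H$ with $A e_n=-c_0\pi^2n^2e_n$, that is, $D(A)=\{v\in H:\sum_{n}|c_0\pi^2n^2\langle e_n,v\rangle_H|^2<\infty\}$ and $Av=-\sum_n c_0\pi^2n^2\langle e_n,v\rangle_He_n$, and let $e^{tA}$, $t\ge0$, be the semigroup generated by $A$. For $r\ge 0$ let $H_r=D((-A)^r)$ with the norm $\|v\|_{H_r}=\|(-A)^rv\|_H$. Let $F\colon H_{1/2}\to H$ be given by $F(w)=c_1\,w\,\partial w$, where $\partial w\in H$ is the weak derivative of $w$. For every finite set $I\subseteq\mathbb{H}$ let $P_I\colon H\to H$, $P_Iv=\sum_{h\in I}\langle h,v\rangle_H\,h$. Let $T\in(0,\infty)$, $\iota\in[0,1)$, $\gamma\in(\tfrac14,\infty)$, $\xi\in H_\iota$.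 For every finite $I\subseteq\mathbb{H}$ let $O^I,X^I\colon[0,T]\to P_I(H)$ be continuous functions such that $$\sup_{I\subseteq\mathbb{H}\text{ finite}}\ \sup_{u\in[0,T]}\|O^I_u\|_{H_{\max\{\gamma,\iota\}}}<\infty$$ and such that for every finite $I\subseteq\mathbb{H}$ and every $t\in[0,T]$ $$X^I_t=e^{tA}P_I\xi+\int_0^te^{(t-s)A}P_IF(X^I_s)\,ds+O^I_t .$$ Then $$\sup_{I\subseteq\mathbb{H}\text{ finite}}\ \sup_{t\in[0,T]}\|X^I_t\|_{H_\iota}<\infty .$$ -/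

import Mathlib

open MeasureTheory Set
open scoped ContDiff

noncomputable section

namespace Burgers

/-- The Lebesgue measure `λ` on the interval `(0,1)`. -/
abbrev lam : Measure ℝ := volume.restrict (Ioo (0 : ℝ) 1)

/-- The real Hilbert space `H = L²(λ; ℝ)`. -/
abbrev H : Type := Lp ℝ 2 lam

theorem memLp_sine (n : ℕ+) :
    MemLp (fun x : ℝ => √2 * Real.sin (n * Real.pi * x)) 2 lam := by
  refine MemLp.of_bound (by fun_prop) (√2) (Filter.Eventually.of_forall fun x => ?_)
  rw [norm_mul, Real.norm_of_nonneg (Real.sqrt_nonneg 2)]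
  exact mul_le_of_le_one_right (Real.sqrt_nonneg 2) (Real.abs_sin_le_one _)

/-- `e_n`, the class in `H` of the function `x ↦ √2 sin(n π x)`, for `n = 1, 2, 3, …`. -/
def e (n : ℕ+) : H := (memLp_sine n).toLp

/-- The orthonormal basis `ℍ = {e_n : n = 1, 2, 3, …}` of `H`. -/
def basisSet : Set H := Set.range e

/-- The eigenvalue `-c₀ π² n²` of the operator `A` belonging to the eigenvector `e_n`. -/
def eigenvalue (c₀ : ℝ) (n : ℕ+) : ℝ := -c₀ * Real.pi ^ 2 * (n : ℝ) ^ 2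

/-- The domain of `f(A)`, where `A` is the diagonal operator with `A e_n = -c₀ π² n² e_n`.
The choice `f x = x` gives `D(A)`. -/
def spectralDomain (c₀ : ℝ) (f : ℝ → ℝ) : Set H :=
  {v | Summable fun n : ℕ+ => |f (eigenvalue c₀ n) * inner ℝ (e n) v| ^ 2}

/-- The operator `f(A) v = ∑ₙ f(-c₀ π² n²) ⟨e_n, v⟩ e_n`, for `v` in the domain of `f(A)`.
The choice `f x = x` gives `A`. -/
def spectralApply (c₀ : ℝ) (f : ℝ → ℝ) (v : H) : H :=
  ∑' n : ℕ+, (f (eigenvalue c₀ n) * inner ℝ (e n) v) • e n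

/-- The interpolation space `H_r = D((-A)^r)`, for `r ≥ 0`. -/
def interpSpace (c₀ r : ℝ) : Set H := spectralDomain c₀ fun x => (-x) ^ r

/-- The norm `‖v‖_{H_r} = ‖(-A)^r v‖_H` of an element `v` of `H_r`, for `r ≥ 0`. -/
def interpNorm (c₀ r : ℝ) (v : H) : ℝ := ‖spectralApply c₀ (fun x => (-x) ^ r) v‖

/-- The semigroup `e^{tA}`, for `t ≥ 0`. -/
def semigroup (c₀ t : ℝ) (v : H) : H := spectralApply c₀ (fun x => Real.exp (t * x)) v

/-- `g ∈ L²` is the weak derivative on `(0,1)` of `v ∈ L²`. -/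
def IsWeakDeriv (v g : H) : Prop :=
  ∀ φ : ℝ → ℝ, ContDiff ℝ ∞ φ → HasCompactSupport φ → tsupport φ ⊆ Ioo (0 : ℝ) 1 →
    ∫ x, g x * φ x ∂lam = -∫ x, v x * deriv φ x ∂lam

open Classical in
/-- The weak derivative `∂v ∈ H` of `v ∈ W^{1,2}((0,1), ℝ)`, that is, of an element `v` of `H`
that has a weak derivative in `H` (which is then unique). The value is `0` for other `v`. -/
def weakDeriv (v : H) : H := if h : ∃ g, IsWeakDeriv v g then h.choose else 0

open Classical in
/-- The Burgers nonlinearity `F(w) = c₁ w ∂w`, for `w ∈ H_{1/2}`. Such a `w` is bounded and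
in `W^{1,2}`, so that the product is in `L²`; the value is `0` where it is not. -/
def nonlinearity (c₁ : ℝ) (w : H) : H :=
  if h : MemLp (fun x => c₁ * (w x * weakDeriv w x)) 2 lam then h.toLp else 0

/-- The spectral Galerkin projection `P_I v = ∑_{h ∈ I} ⟨h, v⟩ h`, for a finite `I ⊆ ℍ`. -/
def proj (I : Finset basisSet) : H →L[ℝ] H :=
  ∑ h ∈ I, (innerSL ℝ (h : H)).smulRight (h : H)

theorem proj_apply (I : Finset basisSet) (v : H) :
    proj I v = ∑ h ∈ I, inner ℝ (h : H) v • (h : H) := by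
  simp [proj]

end Burgers

end

/-! In the basis `e` the equation becomes a finite system of scalar mild equations, and every
estimate is made on the coordinates with constants independent of `I`. Energy bound: `y = X - O` is
differentiable in time even where `O` is not. Since `∫ y² y' = 0`, only products involving `O`
survive in the energy balance, and the dissipation `-2c₀‖∂y‖²` absorbs them as soon as `O` is
bounded in sup norm. That bound is the embedding of `H_ρ` in `L^∞` for `ρ > 1/4`. Grönwall then
bounds `X` in `H` (`energy_inequality`, `IsMildSolution.sum_sub_sq_le`). Bootstrap: as `w ∂w =
(w²)'/2`, the `n`-th coefficient of the nonlinearity is `n` times a Fourier coefficient of `w²`. A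
bound in `H_r` makes the latter `O(n^(-2r))`. The semigroup contributes `n^(-2)`, so the integral
term has coordinates `O(n^(-1-2r))` and lies in `H_{r'}` for every `r' < r + 1/4`
(`IsMildSolution.abs_le`). Steps of `1/5`, starting from `r = 0`, reach `ι < 1` after at most five
rounds. -/

noncomputable section

namespace Burgers

/-! ### Sine and cosine polynomials on the unit interval -/

/-- The function `x ↦ √2 sin(n π x)`. -/
def sine (n : ℕ+) (t : ℝ) : ℝ := √2 * Real.sin (n * Real.pi * t)

/-- The function `x ↦ √2 cos(n π x)`. -/
def cosine (n : ℕ+) (t : ℝ) : ℝ := √2 * Real.cos (n * Real.pi * t)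

/-- The sine polynomial with coefficients `x n`, `n ∈ J`. -/
def sinePoly (J : Finset ℕ+) (x : ℕ+ → ℝ) (t : ℝ) : ℝ := ∑ n ∈ J, x n * sine n t

/-- The derivative of the sine polynomial with coefficients `x n`, `n ∈ J`. -/
def sinePolyDeriv (J : Finset ℕ+) (x : ℕ+ → ℝ) (t : ℝ) : ℝ :=
  ∑ n ∈ J, (n * Real.pi * x n) * cosine n t

/-- The `n`-th sine coefficient of `w ∂w`, for the sine polynomial `w` with coefficients `x`. -/
def burgersCoeff (J : Finset ℕ+) (x : ℕ+ → ℝ) (n : ℕ+) : ℝ :=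
  ∫ t in (0 : ℝ)..1, sine n t * (sinePoly J x t * sinePolyDeriv J x t)

@[fun_prop]
theorem continuous_sine (n : ℕ+) : Continuous (sine n) := by unfold sine; fun_prop

@[fun_prop]
theorem continuous_cosine (n : ℕ+) : Continuous (cosine n) := by unfold cosine; fun_prop

@[fun_prop]
theorem continuous_sinePoly (J : Finset ℕ+) (x : ℕ+ → ℝ) : Continuous (sinePoly J x) := by
  unfold sinePoly; fun_prop

@[fun_prop]
theorem continuous_sinePolyDeriv (J : Finset ℕ+) (x : ℕ+ → ℝ) :
    Continuous (sinePolyDeriv J x) := by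
  unfold sinePolyDeriv; fun_prop

theorem hasDerivAt_sine (n : ℕ+) (t : ℝ) :
    HasDerivAt (sine n) (n * Real.pi * cosine n t) t := by
  unfold sine cosine
  have h := (((hasDerivAt_id' t).const_mul (n * Real.pi)).sin).const_mul (√2)
  exact h.congr_deriv (by ring)

theorem hasDerivAt_sinePoly (J : Finset ℕ+) (x : ℕ+ → ℝ) (t : ℝ) :
    HasDerivAt (sinePoly J x) (sinePolyDeriv J x t) t := by
  unfold sinePoly sinePolyDeriv
  have h := HasDerivAt.fun_sum (u := J) (fun n _ => (hasDerivAt_sine n t).const_mul (x n))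
  exact h.congr_deriv (Finset.sum_congr rfl fun n _ => by ring)

@[simp] theorem sine_zero (n : ℕ+) : sine n 0 = 0 := by simp [sine]

@[simp] theorem sine_one (n : ℕ+) : sine n 1 = 0 := by
  simp only [sine, mul_one]
  rw [Real.sin_nat_mul_pi, mul_zero]

@[simp] theorem sinePoly_zero (J : Finset ℕ+) (x : ℕ+ → ℝ) : sinePoly J x 0 = 0 := by
  simp [sinePoly]

@[simp] theorem sinePoly_one (J : Finset ℕ+) (x : ℕ+ → ℝ) : sinePoly J x 1 = 0 := by
  simp [sinePoly]

theorem abs_sine_le (n : ℕ+) (t : ℝ) : |sine n t| ≤ √2 := by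
  rw [sine, abs_mul, abs_of_nonneg (Real.sqrt_nonneg 2)]
  exact mul_le_of_le_one_right (Real.sqrt_nonneg 2) (Real.abs_sin_le_one _)

theorem sinePoly_add (J : Finset ℕ+) (x y : ℕ+ → ℝ) (t : ℝ) :
    sinePoly J (x + y) t = sinePoly J x t + sinePoly J y t := by
  simp [sinePoly, add_mul, Finset.sum_add_distrib]

theorem abs_sinePoly_le (J : Finset ℕ+) (x : ℕ+ → ℝ) (t : ℝ) :
    |sinePoly J x t| ≤ √2 * ∑ n ∈ J, |x n| := by
  rw [Finset.mul_sum]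
  refine (Finset.abs_sum_le_sum_abs _ _).trans (Finset.sum_le_sum fun n _ => ?_)
  rw [abs_mul, mul_comm]
  exact mul_le_mul_of_nonneg_right (abs_sine_le n t) (abs_nonneg _)

theorem integral_cos_int_mul_pi (k : ℤ) :
    ∫ t in (0 : ℝ)..1, Real.cos (k * Real.pi * t) = if k = 0 then 1 else 0 := by
  split_ifs with h
  · simp [h]
  · have h' : (k : ℝ) * Real.pi ≠ 0 := mul_ne_zero (by exact_mod_cast h) Real.pi_ne_zero
    rw [intervalIntegral.integral_comp_mul_left (fun u => Real.cos u) h']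
    simp [Real.sin_int_mul_pi]

theorem sine_mul_sine (n m : ℕ+) (t : ℝ) :
    sine n t * sine m t = Real.cos (((n : ℤ) - (m : ℤ) : ℤ) * Real.pi * t)
      - Real.cos (((n : ℤ) + (m : ℤ) : ℤ) * Real.pi * t) := by
  have h2 : √2 * √2 = 2 := Real.mul_self_sqrt (by norm_num)
  push_cast
  rw [show ((n : ℝ) - m) * Real.pi * t = n * Real.pi * t - m * Real.pi * t by ring,
    show ((n : ℝ) + m) * Real.pi * t = n * Real.pi * t + m * Real.pi * t by ring,
    Real.cos_sub, Real.cos_add, sine, sine]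
  linear_combination (Real.sin (n * Real.pi * t) * Real.sin (m * Real.pi * t)) * h2

theorem cosine_mul_cosine (n m : ℕ+) (t : ℝ) :
    cosine n t * cosine m t = Real.cos (((n : ℤ) - (m : ℤ) : ℤ) * Real.pi * t)
      + Real.cos (((n : ℤ) + (m : ℤ) : ℤ) * Real.pi * t) := by
  have h2 : √2 * √2 = 2 := Real.mul_self_sqrt (by norm_num)
  push_cast
  rw [show ((n : ℝ) - m) * Real.pi * t = n * Real.pi * t - m * Real.pi * t by ring,
    show ((n : ℝ) + m) * Real.pi * t = n * Real.pi * t + m * Real.pi * t by ring,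
    Real.cos_sub, Real.cos_add, cosine, cosine]
  linear_combination (Real.cos (n * Real.pi * t) * Real.cos (m * Real.pi * t)) * h2

theorem integral_sine_mul_sine (n m : ℕ+) :
    ∫ t in (0 : ℝ)..1, sine n t * sine m t = if n = m then 1 else 0 := by
  simp_rw [sine_mul_sine]
  rw [intervalIntegral.integral_sub (Continuous.intervalIntegrable (by fun_prop) _ _)
    (Continuous.intervalIntegrable (by fun_prop) _ _), integral_cos_int_mul_pi,
    integral_cos_int_mul_pi]
  have hn := n.pos
  have hm := m.pos
  rw [if_neg (show ¬ ((n : ℤ) + (m : ℤ) = 0) by omega), sub_zero]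
  refine if_congr ?_ rfl rfl
  rw [← PNat.coe_inj]
  omega

theorem integral_cosine_mul_cosine (n m : ℕ+) :
    ∫ t in (0 : ℝ)..1, cosine n t * cosine m t = if n = m then 1 else 0 := by
  simp_rw [cosine_mul_cosine]
  rw [intervalIntegral.integral_add (Continuous.intervalIntegrable (by fun_prop) _ _)
    (Continuous.intervalIntegrable (by fun_prop) _ _), integral_cos_int_mul_pi,
    integral_cos_int_mul_pi]
  have hn := n.pos
  have hm := m.pos
  rw [if_neg (show ¬ ((n : ℤ) + (m : ℤ) = 0) by omega), add_zero]
  refine if_congr ?_ rfl rfl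
  rw [← PNat.coe_inj]
  omega

theorem cosine_mul_sine_mul_sine (n k m : ℕ+) (t : ℝ) :
    cosine n t * (sine k t * sine m t) = √2 / 2 *
      ((Real.cos (((n : ℤ) + k - m : ℤ) * Real.pi * t)
          + Real.cos (((n : ℤ) + m - k : ℤ) * Real.pi * t))
        - (Real.cos (((n : ℤ) + k + m : ℤ) * Real.pi * t)
          + Real.cos (((n : ℤ) - k - m : ℤ) * Real.pi * t))) := by
  rw [sine_mul_sine, cosine]
  push_cast
  set a := (n : ℝ) * Real.pi * t with ha
  set b := ((k : ℝ) - m) * Real.pi * t with hb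
  set c := ((k : ℝ) + m) * Real.pi * t with hc
  rw [show ((n : ℝ) + k - m) * Real.pi * t = a + b by rw [ha, hb]; ring,
    show ((n : ℝ) + m - k) * Real.pi * t = a - b by rw [ha, hb]; ring,
    show ((n : ℝ) + k + m) * Real.pi * t = a + c by rw [ha, hc]; ring,
    show ((n : ℝ) - k - m) * Real.pi * t = a - c by rw [ha, hc]; ring,
    Real.cos_add, Real.cos_sub, Real.cos_add, Real.cos_sub]
  ring

/-- Only triads in which one frequency is the sum of the other two interact. Each of them
contributes `±√2/2`, of modulus at most `1`. -/
theorem abs_integral_cosine_mul_sine_mul_sine_le (n k m : ℕ+) :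
    |∫ t in (0 : ℝ)..1, cosine n t * (sine k t * sine m t)| ≤
      (if m = n + k then 1 else 0) + (if k = n + m then 1 else 0) +
        (if n = k + m then 1 else 0) := by
  have hc : ∀ j : ℤ, IntervalIntegrable (fun t : ℝ => Real.cos (j * Real.pi * t)) volume 0 1 :=
    fun j => Continuous.intervalIntegrable (by fun_prop) _ _
  simp_rw [cosine_mul_sine_mul_sine]
  rw [intervalIntegral.integral_const_mul,
    intervalIntegral.integral_sub ((hc _).add (hc _)) ((hc _).add (hc _)),
    intervalIntegral.integral_add (hc _) (hc _), intervalIntegral.integral_add (hc _) (hc _)]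
  simp only [integral_cos_int_mul_pi]
  have hn := n.pos
  have hk := k.pos
  have hm := m.pos
  have h2 : √2 ≤ 2 := Real.sqrt_le_iff.2 ⟨by norm_num, by norm_num⟩
  have h0 := Real.sqrt_nonneg 2
  rw [if_neg (show ¬ ((n : ℤ) + k + m = 0) by omega)]
  have e1 : ((n : ℤ) + k - m = 0) ↔ m = n + k := by
    rw [← PNat.coe_inj, PNat.add_coe]; omega
  have e2 : ((n : ℤ) + m - k = 0) ↔ k = n + m := by
    rw [← PNat.coe_inj, PNat.add_coe]; omega
  have e3 : ((n : ℤ) - k - m = 0) ↔ n = k + m := by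
    rw [← PNat.coe_inj, PNat.add_coe]; omega
  simp only [e1, e2, e3]
  rw [abs_le]
  constructor <;> split_ifs <;> linarith

theorem integral_sum_mul_sum (J : Finset ℕ+) (f : ℕ+ → ℝ → ℝ) (hf : ∀ n, Continuous (f n))
    (hff : ∀ n m, ∫ t in (0 : ℝ)..1, f n t * f m t = if n = m then 1 else 0) (x : ℕ+ → ℝ) :
    ∫ t in (0 : ℝ)..1, (∑ n ∈ J, x n * f n t) ^ 2 = ∑ n ∈ J, x n ^ 2 := by
  simp_rw [sq, Finset.sum_mul_sum]
  rw [intervalIntegral.integral_finsetSum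
    (fun n _ => Continuous.intervalIntegrable (by fun_prop) _ _)]
  refine Finset.sum_congr rfl fun n hn => ?_
  rw [intervalIntegral.integral_finsetSum
    (fun n _ => Continuous.intervalIntegrable (by fun_prop) _ _)]
  have h : ∀ m, ∫ t in (0 : ℝ)..1, x n * f n t * (x m * f m t) =
      x n * x m * if n = m then 1 else 0 := fun m => by
    rw [← hff, ← intervalIntegral.integral_const_mul]
    exact intervalIntegral.integral_congr fun t _ => by ring
  simp [h, hn]

theorem integral_sinePoly_sq (J : Finset ℕ+) (x : ℕ+ → ℝ) :
    ∫ t in (0 : ℝ)..1, sinePoly J x t ^ 2 = ∑ n ∈ J, x n ^ 2 :=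
  integral_sum_mul_sum J sine continuous_sine integral_sine_mul_sine x

theorem integral_sinePolyDeriv_sq (J : Finset ℕ+) (x : ℕ+ → ℝ) :
    ∫ t in (0 : ℝ)..1, sinePolyDeriv J x t ^ 2 = ∑ n ∈ J, (n * Real.pi * x n) ^ 2 :=
  integral_sum_mul_sum J cosine continuous_cosine integral_cosine_mul_cosine
    (fun n => n * Real.pi * x n)

/-! ### The Burgers nonlinearity and the energy inequality -/

/-- Integration by parts for functions that vanish at the endpoints, in the form
`∫ v w w' = -½ ∫ v' w²`. -/
theorem integral_mul_sinePoly_mul_deriv (J : Finset ℕ+) (x : ℕ+ → ℝ) (v v' : ℝ → ℝ)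
    (hv : ∀ t, HasDerivAt v (v' t) t) (hv' : Continuous v') :
    ∫ t in (0 : ℝ)..1, v t * (sinePoly J x t * sinePolyDeriv J x t) =
      -(1 / 2) * ∫ t in (0 : ℝ)..1, v' t * sinePoly J x t ^ 2 := by
  have hvc : Continuous v := continuous_iff_continuousAt.2 fun t => (hv t).continuousAt
  have h := intervalIntegral.integral_mul_deriv_eq_deriv_mul (a := (0 : ℝ)) (b := 1)
    (u := v) (v := fun t => sinePoly J x t ^ 2) (u' := v')
    (v' := fun t => 2 * (sinePoly J x t * sinePolyDeriv J x t))
    (fun t _ => hv t)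
    (fun t _ => by
      exact ((hasDerivAt_sinePoly J x t).fun_pow 2).congr_deriv (by push_cast; ring))
    (hv'.intervalIntegrable _ _) (Continuous.intervalIntegrable (by fun_prop) _ _)
  simp only [sinePoly_zero, sinePoly_one, ne_eq, OfNat.ofNat_ne_zero, not_false_eq_true, zero_pow,
    mul_zero, sub_zero, zero_sub] at h
  have h3 : ∀ t, v t * (2 * (sinePoly J x t * sinePolyDeriv J x t)) =
    2 * (v t * (sinePoly J x t * sinePolyDeriv J x t)) := fun t => by ring
  simp_rw [h3] at h
  rw [intervalIntegral.integral_const_mul] at h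
  linarith

/-- Moving the derivative onto `sine n` costs only one factor `n`, against the `n²` of the
eigenvalue. -/
theorem burgersCoeff_eq (J : Finset ℕ+) (x : ℕ+ → ℝ) (n : ℕ+) :
    burgersCoeff J x n =
      -(n * Real.pi / 2) * ∫ t in (0 : ℝ)..1, cosine n t * sinePoly J x t ^ 2 := by
  rw [burgersCoeff, integral_mul_sinePoly_mul_deriv J x _ _ (hasDerivAt_sine n) (by fun_prop)]
  simp_rw [mul_assoc]
  rw [intervalIntegral.integral_const_mul, intervalIntegral.integral_const_mul]
  ring

theorem integral_cosine_mul_sinePoly_sq (J : Finset ℕ+) (x : ℕ+ → ℝ) (n : ℕ+) :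
    ∫ t in (0 : ℝ)..1, cosine n t * sinePoly J x t ^ 2 =
      ∑ k ∈ J, ∑ m ∈ J, x k * x m * ∫ t in (0 : ℝ)..1, cosine n t * (sine k t * sine m t) := by
  simp_rw [sq, sinePoly, Finset.sum_mul_sum, Finset.mul_sum]
  rw [intervalIntegral.integral_finsetSum
    (fun n _ => Continuous.intervalIntegrable (by fun_prop) _ _)]
  refine Finset.sum_congr rfl fun k hk => ?_
  rw [intervalIntegral.integral_finsetSum
    (fun n _ => Continuous.intervalIntegrable (by fun_prop) _ _)]
  refine Finset.sum_congr rfl fun m hm => ?_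
  rw [← intervalIntegral.integral_const_mul]
  exact intervalIntegral.integral_congr fun t _ => by ring

/-- The coefficient is a quadratic polynomial in the finitely many `x k`, `k ∈ J`. -/
theorem continuous_burgersCoeff (J : Finset ℕ+) (n : ℕ+) :
    Continuous fun x : ℕ+ → ℝ => burgersCoeff J x n := by
  simp_rw [burgersCoeff_eq, integral_cosine_mul_sinePoly_sq]
  fun_prop

theorem sum_mul_burgersCoeff (J : Finset ℕ+) (x y : ℕ+ → ℝ) :
    ∑ n ∈ J, y n * burgersCoeff J x n =
      -(1 / 2) * ∫ t in (0 : ℝ)..1, sinePolyDeriv J y t * sinePoly J x t ^ 2 := by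
  rw [← integral_mul_sinePoly_mul_deriv J x _ _ (hasDerivAt_sinePoly J y) (by fun_prop)]
  simp_rw [burgersCoeff, ← intervalIntegral.integral_const_mul]
  rw [← intervalIntegral.integral_finsetSum
    (fun n _ => Continuous.intervalIntegrable (by fun_prop) _ _)]
  refine intervalIntegral.integral_congr fun t _ => ?_
  simp only [sinePoly, Finset.sum_mul]
  exact Finset.sum_congr rfl fun n _ => by ring

/-- Integration by parts shows that the integral equals `-1/2` times itself. This removes the cubic
term from the energy balance. -/
theorem integral_sinePolyDeriv_mul_sinePoly_sq (J : Finset ℕ+) (y : ℕ+ → ℝ) :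
    ∫ t in (0 : ℝ)..1, sinePolyDeriv J y t * sinePoly J y t ^ 2 = 0 := by
  have h := integral_mul_sinePoly_mul_deriv J y _ _ (hasDerivAt_sinePoly J y) (by fun_prop)
  have h2 : ∀ t, sinePoly J y t * (sinePoly J y t * sinePolyDeriv J y t) =
    sinePolyDeriv J y t * sinePoly J y t ^ 2 := fun t => by ring
  simp_rw [h2] at h
  linarith

/-- The energy inequality for the Burgers nonlinearity perturbed by a bounded function. -/
theorem energy_inequality (J : Finset ℕ+) (y o : ℕ+ → ℝ) {c₀ c₁ K : ℝ} (hc₀ : 0 < c₀)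
    (hK : ∀ t, |sinePoly J o t| ≤ K) :
    ∑ n ∈ J, 2 * y n * (eigenvalue c₀ n * y n + c₁ * burgersCoeff J (y + o) n) ≤
      c₁ ^ 2 / c₀ * (K ^ 2 * ∑ n ∈ J, y n ^ 2 + K ^ 4) := by
  have h1 : ∑ n ∈ J, 2 * y n * (eigenvalue c₀ n * y n + c₁ * burgersCoeff J (y + o) n) =
      -2 * c₀ * (∑ n ∈ J, (n * Real.pi * y n) ^ 2)
        + 2 * c₁ * ∑ n ∈ J, y n * burgersCoeff J (y + o) n := by
    rw [Finset.mul_sum, Finset.mul_sum, ← Finset.sum_add_distrib]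
    exact Finset.sum_congr rfl fun n _ => by rw [eigenvalue]; ring
  rw [h1, sum_mul_burgersCoeff, ← integral_sinePolyDeriv_sq, ← integral_sinePoly_sq]
  have h2 : ∫ t in (0 : ℝ)..1, sinePolyDeriv J y t * sinePoly J (y + o) t ^ 2 =
      ∫ t in (0 : ℝ)..1, sinePolyDeriv J y t *
        (2 * sinePoly J y t * sinePoly J o t + sinePoly J o t ^ 2) := by
    have h0 : (∫ t in (0 : ℝ)..1, sinePolyDeriv J y t * sinePoly J (y + o) t ^ 2) -
        (∫ t in (0 : ℝ)..1, sinePolyDeriv J y t * sinePoly J y t ^ 2) =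
        ∫ t in (0 : ℝ)..1, sinePolyDeriv J y t * sinePoly J (y + o) t ^ 2 := by
      rw [integral_sinePolyDeriv_mul_sinePoly_sq, sub_zero]
    rw [← h0, ← intervalIntegral.integral_sub (Continuous.intervalIntegrable (by fun_prop) _ _)
        (Continuous.intervalIntegrable (by fun_prop) _ _)]
    exact intervalIntegral.integral_congr fun t _ => by simp only [sinePoly_add]; ring
  -- With `K ^ 4` as an integral over an interval of length one, the claim reduces to a pointwise
  -- inequality of integrands.
  have h3 : K ^ 4 = ∫ t in (0 : ℝ)..1, K ^ 4 := by simp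
  rw [h2, h3, ← intervalIntegral.integral_const_mul (K ^ 2),
    ← intervalIntegral.integral_add (Continuous.intervalIntegrable (by fun_prop) _ _)
      (Continuous.intervalIntegrable (by fun_prop) _ _),
    ← mul_assoc, ← intervalIntegral.integral_const_mul, ← intervalIntegral.integral_const_mul,
    ← intervalIntegral.integral_const_mul,
    ← intervalIntegral.integral_add (Continuous.intervalIntegrable (by fun_prop) _ _)
      (Continuous.intervalIntegrable (by fun_prop) _ _)]
  refine intervalIntegral.integral_mono_on zero_le_one
    (Continuous.intervalIntegrable (by fun_prop) _ _)
    (Continuous.intervalIntegrable (by fun_prop) _ _) fun t _ => ?_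
  have ho : sinePoly J o t ^ 2 ≤ K ^ 2 := sq_le_sq' (by linarith [(abs_le.1 (hK t)).1])
    (abs_le.1 (hK t)).2
  set d := sinePolyDeriv J y t
  set Y := sinePoly J y t
  set o' := sinePoly J o t
  have ho4 : o' ^ 4 ≤ K ^ 4 := by nlinarith [sq_nonneg o', sq_nonneg K]
  have hY : Y ^ 2 * o' ^ 2 ≤ Y ^ 2 * K ^ 2 := mul_le_mul_of_nonneg_left ho (sq_nonneg Y)
  have hz : (2 * Y * o' + o' ^ 2) ^ 2 ≤ 8 * (K ^ 2 * Y ^ 2 + K ^ 4) := by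
    nlinarith [sq_nonneg (2 * Y * o' - o' ^ 2), sq_nonneg (K ^ 2)]
  -- Complete the square in `d`: the dissipation absorbs the term linear in `d`.
  have hy : -2 * c₀ * d ^ 2 + 2 * c₁ * -(1 / 2) * (d * (2 * Y * o' + o' ^ 2)) ≤
      c₁ ^ 2 / c₀ * ((2 * Y * o' + o' ^ 2) ^ 2 / 8) := by
    rw [div_mul_eq_mul_div, le_div_iff₀ hc₀]
    nlinarith [sq_nonneg (4 * c₀ * d + c₁ * (2 * Y * o' + o' ^ 2))]
  refine hy.trans (mul_le_mul_of_nonneg_left ?_ (by positivity))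
  linarith

/-! ### Decay of the coefficients of the nonlinearity -/

theorem sum_ite_le_one (J : Finset ℕ+) (p : ℕ+ → Prop) [DecidablePred p]
    (hp : ∀ a b, p a → p b → a = b) : ∑ m ∈ J, (if p m then (1 : ℝ) else 0) ≤ 1 := by
  rw [Finset.sum_boole]
  exact_mod_cast Finset.card_le_one.2 fun a ha b hb =>
    hp a b (Finset.mem_filter.1 ha).2 (Finset.mem_filter.1 hb).2

theorem one_le_rpow (n : ℕ+) {r : ℝ} (hr : 0 ≤ r) : 1 ≤ (n : ℝ) ^ r :=
  Real.one_le_rpow (by exact_mod_cast one_le (a := n)) hr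

theorem rpow_mul_sq (n : ℕ+) (r : ℝ) : ((n : ℝ) ^ (2 * r)) ^ 2 = (n : ℝ) ^ (4 * r) := by
  rw [← Real.rpow_natCast, ← Real.rpow_mul (by positivity)]
  congr 1; push_cast; ring

/-- Since `n ≤ 2 max k m`, the weight of `n` is at most four times the sum of the weights of `k` and
`m`. Young's inequality separates the factors, and weights at least `1` can be added to the
unweighted squares. -/
theorem rpow_mul_mul_le {n k m : ℕ+} (h : (n : ℝ) ≤ k + m) {r : ℝ} (hr₀ : 0 ≤ r) (hr₁ : r ≤ 1)
    (a b : ℝ) : (n : ℝ) ^ (2 * r) * (|a| * |b|) ≤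
      4 * ((k : ℝ) ^ (4 * r) * a ^ 2 + (m : ℝ) ^ (4 * r) * b ^ 2) := by
  have h2 : (2 : ℝ) ^ (2 * r) ≤ 4 := by
    calc (2 : ℝ) ^ (2 * r) ≤ 2 ^ (2 : ℝ) := Real.rpow_le_rpow_of_exponent_le (by norm_num)
          (by linarith)
      _ = 4 := by norm_num
  have hk : 1 ≤ (k : ℝ) ^ (2 * r) := one_le_rpow k (by linarith)
  have hm : 1 ≤ (m : ℝ) ^ (2 * r) := one_le_rpow m (by linarith)
  have hn : (n : ℝ) ^ (2 * r) ≤ 4 * ((k : ℝ) ^ (2 * r) + (m : ℝ) ^ (2 * r)) := by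
    have hmax : (n : ℝ) ≤ 2 * max (k : ℝ) m := by
      linarith [le_max_left (k : ℝ) m, le_max_right (k : ℝ) m]
    calc (n : ℝ) ^ (2 * r) ≤ (2 * max (k : ℝ) m) ^ (2 * r) :=
          Real.rpow_le_rpow (by positivity) hmax (by linarith)
      _ = 2 ^ (2 * r) * (max (k : ℝ) m) ^ (2 * r) := Real.mul_rpow (by norm_num) (by positivity)
      _ ≤ 4 * (max (k : ℝ) m) ^ (2 * r) := by gcongr
      _ ≤ 4 * ((k : ℝ) ^ (2 * r) + (m : ℝ) ^ (2 * r)) := by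
        gcongr
        rcases le_total (k : ℝ) m with h' | h'
        · rw [max_eq_right h']; linarith
        · rw [max_eq_left h']; linarith
  rw [← rpow_mul_sq, ← rpow_mul_sq, ← sq_abs a, ← sq_abs b]
  set u := |a|
  set v := |b|
  have hu : 0 ≤ u := abs_nonneg a
  have hv : 0 ≤ v := abs_nonneg b
  set p := (k : ℝ) ^ (2 * r)
  set q := (m : ℝ) ^ (2 * r)
  have h3 : (n : ℝ) ^ (2 * r) * (u * v) ≤ 4 * (p + q) * (u * v) :=
    mul_le_mul_of_nonneg_right hn (by positivity)
  have h4 : u ^ 2 ≤ p ^ 2 * u ^ 2 := le_mul_of_one_le_left (sq_nonneg u) (one_le_pow₀ hk)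
  have h5 : v ^ 2 ≤ q ^ 2 * v ^ 2 := le_mul_of_one_le_left (sq_nonneg v) (one_le_pow₀ hm)
  nlinarith [sq_nonneg (p * u - v), sq_nonneg (q * v - u)]

/-- A Schur test: for fixed `n`, each row and each column of the interaction matrix `δ` sums to at
most `3`. Hence `24 = 4 * (3 + 3)`. -/
theorem rpow_mul_abs_integral_cosine_mul_sinePoly_sq_le (J : Finset ℕ+) (x : ℕ+ → ℝ) (n : ℕ+)
    {r : ℝ} (hr₀ : 0 ≤ r) (hr₁ : r ≤ 1) :
    (n : ℝ) ^ (2 * r) * |∫ t in (0 : ℝ)..1, cosine n t * sinePoly J x t ^ 2| ≤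
      24 * ∑ k ∈ J, (k : ℝ) ^ (4 * r) * x k ^ 2 := by
  set w : ℕ+ → ℝ := fun k => (k : ℝ) ^ (4 * r) * x k ^ 2 with hw
  have hw0 : ∀ k, 0 ≤ w k := fun k => by positivity
  set δ : ℕ+ → ℕ+ → ℝ := fun k m => (if m = n + k then 1 else 0) + (if k = n + m then 1 else 0) +
        (if n = k + m then 1 else 0) with hδ
  have hδ0 : ∀ k m, 0 ≤ δ k m := fun k m => by
    simp only [hδ]; split_ifs <;> norm_num
  have hδk : ∀ k, ∑ m ∈ J, δ k m ≤ 3 := fun k => by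
    simp only [hδ, Finset.sum_add_distrib]
    have h1 := sum_ite_le_one J (fun m => m = n + k) (fun a b ha hb => ha.trans hb.symm)
    have h2 := sum_ite_le_one J (fun m => k = n + m)
      (fun a b ha hb => add_left_cancel (ha.symm.trans hb))
    have h3 := sum_ite_le_one J (fun m => n = k + m)
      (fun a b ha hb => add_left_cancel (ha.symm.trans hb))
    linarith
  have hδm : ∀ m, ∑ k ∈ J, δ k m ≤ 3 := fun m => by
    simp only [hδ, Finset.sum_add_distrib]
    have h1 := sum_ite_le_one J (fun k => m = n + k)
      (fun a b ha hb => add_left_cancel (ha.symm.trans hb))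
    have h2 := sum_ite_le_one J (fun k => k = n + m) (fun a b ha hb => ha.trans hb.symm)
    have h3 := sum_ite_le_one J (fun k => n = k + m)
      (fun a b ha hb => add_right_cancel (ha.symm.trans hb))
    linarith
  have hterm : ∀ k m, (n : ℝ) ^ (2 * r) *
      |x k * x m * ∫ t in (0 : ℝ)..1, cosine n t * (sine k t * sine m t)| ≤
      4 * (w k * δ k m + w m * δ k m) := fun k m => by
    have hI := abs_integral_cosine_mul_sine_mul_sine_le n k m
    rw [abs_mul, abs_mul, ← mul_assoc]
    refine (mul_le_mul_of_nonneg_left hI (by positivity)).trans ?_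
    -- Each of the three resonances forces `n ≤ k + m`; otherwise `δ k m = 0`.
    by_cases h : (n : ℝ) ≤ k + m
    · have := mul_le_mul_of_nonneg_right (rpow_mul_mul_le h hr₀ hr₁ (x k) (x m)) (hδ0 k m)
      refine this.trans (le_of_eq ?_)
      simp only [hw]; ring
    · have h1 : ¬ m = n + k := fun h' => h (by
        rw [h']; push_cast; linarith [(Nat.cast_nonneg (k : ℕ) : (0 : ℝ) ≤ (k : ℕ))])
      have h2 : ¬ k = n + m := fun h' => h (by
        rw [h']; push_cast; linarith [(Nat.cast_nonneg (m : ℕ) : (0 : ℝ) ≤ (m : ℕ))])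
      have h3 : ¬ n = k + m := fun h' => h (by rw [h']; push_cast; rfl)
      simp [hδ, h1, h2, h3]
  rw [integral_cosine_mul_sinePoly_sq]
  calc (n : ℝ) ^ (2 * r) * |∑ k ∈ J, ∑ m ∈ J,
        x k * x m * ∫ t in (0 : ℝ)..1, cosine n t * (sine k t * sine m t)|
      ≤ ∑ k ∈ J, ∑ m ∈ J, 4 * (w k * δ k m + w m * δ k m) := by
        refine (mul_le_mul_of_nonneg_left ((Finset.abs_sum_le_sum_abs _ _).trans
          (Finset.sum_le_sum fun k _ => Finset.abs_sum_le_sum_abs _ _)) (by positivity)).trans ?_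
        simp_rw [Finset.mul_sum]
        exact Finset.sum_le_sum fun k _ => Finset.sum_le_sum fun m _ => hterm k m
    _ = 4 * (∑ k ∈ J, w k * ∑ m ∈ J, δ k m + ∑ m ∈ J, w m * ∑ k ∈ J, δ k m) := by
        simp_rw [← Finset.mul_sum, Finset.sum_add_distrib, Finset.mul_sum]
        congr 2
        exact Finset.sum_comm
    _ ≤ 4 * (∑ k ∈ J, w k * 3 + ∑ m ∈ J, w m * 3) := by
        gcongr with k _ m _
        · exact hδk k
        · exact hδm m
    _ = 24 * ∑ k ∈ J, w k := by rw [← Finset.sum_mul]; ring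

theorem rpow_mul_abs_burgersCoeff_le (J : Finset ℕ+) (x : ℕ+ → ℝ) (n : ℕ+)
    {r : ℝ} (hr₀ : 0 ≤ r) (hr₁ : r ≤ 1) :
    (n : ℝ) ^ (2 * r) * |burgersCoeff J x n| ≤
      12 * Real.pi * n * ∑ k ∈ J, (k : ℝ) ^ (4 * r) * x k ^ 2 := by
  have h := rpow_mul_abs_integral_cosine_mul_sinePoly_sq_le J x n hr₀ hr₁
  have hp : 0 < (n : ℝ) * Real.pi / 2 := by have := n.pos; positivity
  rw [burgersCoeff_eq, abs_mul, abs_neg, abs_of_pos hp]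
  nlinarith [mul_le_mul_of_nonneg_left h hp.le]

/-! ### Scalar mild equations -/

/-- Pulling `exp (t * l)` out of the integral leaves a primitive of a continuous function. The lemma
is meant for the coordinates of `X - O`. -/
theorem continuousOn_and_hasDerivAt_of_mild {T l ξ : ℝ} {g y : ℝ → ℝ}
    (hg : ContinuousOn g (Icc 0 T))
    (hy : ∀ t ∈ Icc 0 T,
      y t = Real.exp (t * l) * ξ + ∫ s in (0 : ℝ)..t, Real.exp ((t - s) * l) * g s) :
    ContinuousOn y (Icc 0 T) ∧ ∀ t ∈ Ioo 0 T, HasDerivAt y (l * y t + g t) t := by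
  set h : ℝ → ℝ := fun s => Real.exp (-s * l) * g s with hh
  have hhc : ContinuousOn h (Icc 0 T) := by
    apply ContinuousOn.mul (by fun_prop) hg
  set z : ℝ → ℝ := fun t => Real.exp (t * l) * (ξ + ∫ s in (0 : ℝ)..t, h s) with hz
  have hyz : ∀ t ∈ Icc 0 T, y t = z t := fun t ht => by
    rw [hy t ht, hz]
    simp only [mul_add]
    rw [← intervalIntegral.integral_const_mul]
    congr 1
    refine intervalIntegral.integral_congr fun s _ => ?_
    simp only [hh]
    rw [← mul_assoc, ← Real.exp_add]
    ring_nf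
  have hzc : ContinuousOn z (Icc 0 T) := by
    refine ContinuousOn.mul (by fun_prop) (continuousOn_const.add ?_)
    rcases le_or_gt 0 T with hT | hT
    · have := intervalIntegral.continuousOn_primitive_interval (f := h) (μ := volume) (a := 0)
        (b := T) (by rw [uIcc_of_le hT]; exact hhc.integrableOn_Icc)
      rwa [uIcc_of_le hT] at this
    · rw [Icc_eq_empty (not_le.2 hT)]; exact continuousOn_empty _
  refine ⟨hzc.congr hyz, fun t ht => ?_⟩
  have hint : HasDerivAt (fun t => ∫ s in (0 : ℝ)..t, h s) (h t) t := by
    refine intervalIntegral.integral_hasDerivAt_right ?_ ?_ ?_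
    · refine ContinuousOn.intervalIntegrable (hhc.mono ?_)
      rw [uIcc_of_le ht.1.le]
      exact Icc_subset_Icc_right ht.2.le
    · exact ContinuousOn.stronglyMeasurableAtFilter isOpen_Ioo
        (hhc.mono Ioo_subset_Icc_self) t ht
    · exact hhc.continuousAt (Icc_mem_nhds ht.1 ht.2)
  have hexp : HasDerivAt (fun t => Real.exp (t * l)) (Real.exp (t * l) * l) t := by
    simpa using ((hasDerivAt_id' t).mul_const l).exp
  have hzd := hexp.mul (hint.const_add ξ)
  have heq : y =ᶠ[nhds t] z := by
    filter_upwards [Icc_mem_nhds ht.1 ht.2] with s hs using hyz s hs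
  refine (hzd.congr_of_eventuallyEq heq).congr_deriv ?_
  rw [hyz t (Ioo_subset_Icc_self ht)]
  simp only [hz, hh]
  have he : Real.exp (t * l) * Real.exp (-t * l) = 1 := by
    rw [← Real.exp_add]; simp
  linear_combination g t * he

/-- Parabolic smoothing in one coordinate: the kernel has total mass at most `1 / -l`, uniformly in
`t`. -/
theorem abs_integral_exp_mul_le {l G t : ℝ} (hl : l < 0) (ht : 0 ≤ t) {g : ℝ → ℝ}
    (hg : ∀ s ∈ Icc 0 t, |g s| ≤ G) :
    |∫ s in (0 : ℝ)..t, Real.exp ((t - s) * l) * g s| ≤ G / -l := by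
  have hG : 0 ≤ G := (abs_nonneg _).trans (hg 0 ⟨le_rfl, ht⟩)
  have hd : ∀ s ∈ uIcc 0 t, HasDerivAt (fun s => Real.exp ((t - s) * l) * (G / -l))
      (Real.exp ((t - s) * l) * G) s := fun s _ => by
    have h := (((hasDerivAt_id' s).const_sub t).mul_const l).exp.mul_const (G / -l)
    refine h.congr_deriv ?_
    have := hl.ne
    field_simp
  have hi := intervalIntegral.integral_eq_sub_of_hasDerivAt hd
    (Continuous.intervalIntegrable (by fun_prop) _ _)
  have hle : |∫ s in (0 : ℝ)..t, Real.exp ((t - s) * l) * g s| ≤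
      ∫ s in (0 : ℝ)..t, Real.exp ((t - s) * l) * G := by
    refine intervalIntegral.norm_integral_le_of_norm_le (f := fun s =>
      Real.exp ((t - s) * l) * g s) ht ?_ (Continuous.intervalIntegrable (by fun_prop) _ _)
    refine Filter.Eventually.of_forall fun s hs => ?_
    rw [Real.norm_eq_abs, abs_mul, Real.abs_exp]
    exact mul_le_mul_of_nonneg_left (hg s ⟨hs.1.le, hs.2⟩) (Real.exp_pos _).le
  refine hle.trans ?_
  rw [hi]
  have h1 : 0 ≤ G / -l := div_nonneg hG (by linarith)
  have h2 := mul_nonneg (Real.exp_pos ((t - 0) * l)).le h1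
  simp only [sub_self, zero_mul, Real.exp_zero, one_mul]
  linarith

/-! ### A priori bounds for solutions in coordinates -/

/-- `x` is a solution in coordinates of the mild equation
`x_t = e^{tA} P ξ + ∫_0^t e^{(t-s)A} P F(x_s) ds + o_t` on `[0,T]`, where `P` is the projection to
the span of `e_n`, `n ∈ J`. -/
structure IsMildSolution (c₀ c₁ T : ℝ) (J : Finset ℕ+) (ξ : ℕ+ → ℝ) (o x : ℝ → ℕ+ → ℝ) :
    Prop where
  continuousOn : ContinuousOn x (Icc 0 T)
  eq : ∀ t ∈ Icc 0 T, ∀ n ∈ J, x t n = Real.exp (t * eigenvalue c₀ n) * ξ n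
    + (∫ s in (0 : ℝ)..t, Real.exp ((t - s) * eigenvalue c₀ n) * (c₁ * burgersCoeff J (x s) n))
    + o t n

theorem IsMildSolution.sum_sub_sq_le {c₀ c₁ T : ℝ} {J : Finset ℕ+} {ξ : ℕ+ → ℝ}
    {o x : ℝ → ℕ+ → ℝ} (h : IsMildSolution c₀ c₁ T J ξ o x) (hc₀ : 0 < c₀) {K : ℝ}
    (hK : ∀ t ∈ Icc 0 T, ∀ u, |sinePoly J (o t) u| ≤ K) {t : ℝ} (ht : t ∈ Icc 0 T) :
    ∑ n ∈ J, (x t n - o t n) ^ 2 ≤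
      Real.exp (T * (c₁ ^ 2 / c₀ * K ^ 2)) * (∑ n ∈ J, ξ n ^ 2 + K ^ 2) := by
  set b := c₁ ^ 2 / c₀ * K ^ 2 with hb
  have hb0 : 0 ≤ b := by positivity
  have hT : 0 ≤ T := ht.1.trans ht.2
  have hg : ∀ n, ContinuousOn (fun s => c₁ * burgersCoeff J (x s) n) (Icc 0 T) := fun n =>
    continuousOn_const.mul ((continuous_burgersCoeff J n).comp_continuousOn h.continuousOn)
  have hy : ∀ n ∈ J, ContinuousOn (fun t => x t n - o t n) (Icc 0 T) ∧ ∀ t ∈ Ioo 0 T,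
      HasDerivAt (fun t => x t n - o t n)
        (eigenvalue c₀ n * (x t n - o t n) + c₁ * burgersCoeff J (x t) n) t := fun n hn =>
    continuousOn_and_hasDerivAt_of_mild (hg n) fun t ht => by rw [h.eq t ht n hn]; ring
  set E : ℝ → ℝ := fun t => ∑ n ∈ J, (x t n - o t n) ^ 2 with hE
  have hEc : ContinuousOn E (Icc 0 T) := continuousOn_finsetSum _ fun n hn => (hy n hn).1.pow 2
  set E' : ℝ → ℝ := fun t => ∑ n ∈ J, 2 * (x t n - o t n) *
    (eigenvalue c₀ n * (x t n - o t n) + c₁ * burgersCoeff J (x t) n) with hE'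
  have hEd : ∀ t ∈ Ioo 0 T, HasDerivAt E (E' t) t := fun t ht =>
    (HasDerivAt.fun_sum fun n hn => ((hy n hn).2 t ht).fun_pow 2).congr_deriv
      (Finset.sum_congr rfl fun n _ => by push_cast; ring)
  -- Shifting the energy by `K ^ 2` makes the differential inequality homogeneous, so the
  -- integrating factor `exp (-t * b)` gives a decreasing function.
  have hE'le : ∀ t ∈ Ioo 0 T, E' t ≤ b * (E t + K ^ 2) := fun t ht => by
    have := energy_inequality (c₁ := c₁) J (x t - o t) (o t) hc₀ (hK t (Ioo_subset_Icc_self ht))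
    rw [sub_add_cancel] at this
    refine (this : E' t ≤ _).trans (le_of_eq ?_)
    simp only [hE, hb, Pi.sub_apply]
    ring
  have hexp : ∀ t, HasDerivAt (fun t => Real.exp (-t * b)) (-(Real.exp (-t * b) * b)) t :=
    fun t => (((hasDerivAt_id' t).fun_neg).mul_const b).exp.congr_deriv (by ring)
  have hd : ∀ t ∈ Ioo 0 T, HasDerivAt (fun t => Real.exp (-t * b) * (E t + K ^ 2))
      (Real.exp (-t * b) * (E' t - b * (E t + K ^ 2))) t := fun t ht =>
    ((hexp t).fun_mul ((hEd t ht).add_const _)).congr_deriv (by ring)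
  have hanti : AntitoneOn (fun t => Real.exp (-t * b) * (E t + K ^ 2)) (Icc 0 T) := by
    refine antitoneOn_of_deriv_nonpos (convex_Icc 0 T)
      (ContinuousOn.mul (by fun_prop) (hEc.add continuousOn_const)) ?_ ?_
    · rw [interior_Icc]
      exact fun t ht => (hd t ht).differentiableAt.differentiableWithinAt
    · rw [interior_Icc]
      intro t ht
      rw [(hd t ht).deriv]
      exact mul_nonpos_of_nonneg_of_nonpos (Real.exp_pos _).le (by linarith [hE'le t ht])
  have h0 : E 0 = ∑ n ∈ J, ξ n ^ 2 := Finset.sum_congr rfl fun n hn => by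
    rw [h.eq 0 ⟨le_rfl, hT⟩ n hn]; simp
  have h1 := hanti ⟨le_rfl, hT⟩ ht ht.1
  simp only [neg_zero, zero_mul, Real.exp_zero, one_mul, h0] at h1
  have h2 : E t + K ^ 2 ≤ Real.exp (t * b) * (∑ n ∈ J, ξ n ^ 2 + K ^ 2) := by
    have := mul_le_mul_of_nonneg_left h1 (Real.exp_pos (t * b)).le
    rwa [← mul_assoc, ← Real.exp_add, show t * b + -t * b = 0 by ring, Real.exp_zero,
      one_mul] at this
  have h3 : Real.exp (t * b) ≤ Real.exp (T * b) :=
    Real.exp_le_exp.2 (mul_le_mul_of_nonneg_right ht.2 hb0)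
  have h4 : 0 ≤ ∑ n ∈ J, ξ n ^ 2 + K ^ 2 := by positivity
  have h5 := mul_le_mul_of_nonneg_right h3 h4
  have h6 := sq_nonneg K
  change E t ≤ _
  linarith

theorem eigenvalue_neg {c₀ : ℝ} (hc₀ : 0 < c₀) (n : ℕ+) : eigenvalue c₀ n < 0 := by
  have hn : (0 : ℝ) < n := by exact_mod_cast n.pos
  have := Real.pi_pos
  have : 0 < c₀ * Real.pi ^ 2 * (n : ℝ) ^ 2 := by positivity
  rw [eigenvalue]; linarith

/-- The bootstrap estimate. The exponent is `1` from the derivative, `-2` from the semigroup and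
`-2r` from the assumed bound. -/
theorem IsMildSolution.abs_le {c₀ c₁ T : ℝ} {J : Finset ℕ+} {ξ : ℕ+ → ℝ}
    {o x : ℝ → ℕ+ → ℝ} (h : IsMildSolution c₀ c₁ T J ξ o x) (hc₀ : 0 < c₀) {r M : ℝ}
    (hr₀ : 0 ≤ r) (hr₁ : r ≤ 1)
    (hM : ∀ t ∈ Icc 0 T, ∑ k ∈ J, (k : ℝ) ^ (4 * r) * x t k ^ 2 ≤ M)
    {t : ℝ} (ht : t ∈ Icc 0 T) {n : ℕ+} (hn : n ∈ J) :
    |x t n| ≤ |ξ n| + |o t n| +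
      12 * |c₁| * M / (c₀ * Real.pi) * (n : ℝ) ^ (-1 - 2 * r) := by
  have hn0 : (0 : ℝ) < n := by exact_mod_cast n.pos
  have hl := eigenvalue_neg hc₀ n
  have hp := Real.pi_pos
  have hq : (0 : ℝ) < (n : ℝ) ^ (2 * r) := by positivity
  have hg : ∀ s ∈ Icc 0 t, |c₁ * burgersCoeff J (x s) n| ≤
      |c₁| * (12 * Real.pi * n * M / (n : ℝ) ^ (2 * r)) := fun s hs => by
    rw [abs_mul]
    refine mul_le_mul_of_nonneg_left ?_ (abs_nonneg _)
    rw [le_div_iff₀' hq]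
    exact (rpow_mul_abs_burgersCoeff_le J (x s) n hr₀ hr₁).trans
      (mul_le_mul_of_nonneg_left (hM s ⟨hs.1, hs.2.trans ht.2⟩) (by positivity))
  have hi := abs_integral_exp_mul_le hl ht.1 hg
  have he : |Real.exp (t * eigenvalue c₀ n) * ξ n| ≤ |ξ n| := by
    rw [abs_mul, Real.abs_exp]
    exact mul_le_of_le_one_left (abs_nonneg _)
      (Real.exp_le_one_iff.2 (mul_nonpos_of_nonneg_of_nonpos ht.1 hl.le))
  have hpow : (n : ℝ) ^ (-1 - 2 * r) = 1 / (n * (n : ℝ) ^ (2 * r)) := by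
    rw [Real.rpow_sub hn0, Real.rpow_neg_one, one_div, mul_inv, div_eq_mul_inv]
  have hG : |c₁| * (12 * Real.pi * n * M / (n : ℝ) ^ (2 * r)) / -eigenvalue c₀ n =
      12 * |c₁| * M / (c₀ * Real.pi) * (n : ℝ) ^ (-1 - 2 * r) := by
    rw [hpow, eigenvalue]
    field_simp
  rw [hG] at hi
  rw [h.eq t ht n hn]
  refine (abs_add_le _ _).trans ?_
  have := abs_add_le (Real.exp (t * eigenvalue c₀ n) * ξ n) (∫ s in (0 : ℝ)..t,
    Real.exp ((t - s) * eigenvalue c₀ n) * (c₁ * burgersCoeff J (x s) n))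
  linarith

theorem summable_pnat_rpow {p : ℝ} (hp : p < -1) : Summable fun n : ℕ+ => (n : ℝ) ^ p :=
  (Real.summable_nat_rpow.2 hp).comp_injective PNat.coe_injective

/-- The last term has exponent `4r' - 2 - 4r ≤ -6/5`, which is summable. Any gain below `1/4` would
do in place of `1/5`. -/
theorem rpow_mul_sq_le {n : ℕ+} {r r' : ℝ} (hrr : r' ≤ r + 1 / 5) {x a b D : ℝ}
    (h : |x| ≤ |a| + |b| + D * (n : ℝ) ^ (-1 - 2 * r)) :
    (n : ℝ) ^ (4 * r') * x ^ 2 ≤ 3 * ((n : ℝ) ^ (4 * r') * a ^ 2 + (n : ℝ) ^ (4 * r') * b ^ 2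
      + D ^ 2 * (n : ℝ) ^ (-(6 / 5) : ℝ)) := by
  have hn0 : (0 : ℝ) < n := by exact_mod_cast n.pos
  set c := D * (n : ℝ) ^ (-1 - 2 * r) with hc
  have h1 : x ^ 2 ≤ 3 * (a ^ 2 + b ^ 2 + c ^ 2) := by
    have h2 : |x| ^ 2 ≤ (|a| + |b| + c) ^ 2 := by gcongr
    rw [← sq_abs x, ← sq_abs a, ← sq_abs b]
    nlinarith [sq_nonneg (|a| - |b|), sq_nonneg (|a| - c), sq_nonneg (|b| - c)]
  have h3 : (n : ℝ) ^ (4 * r') * c ^ 2 ≤ D ^ 2 * (n : ℝ) ^ (-(6 / 5) : ℝ) := by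
    rw [hc, mul_pow, ← Real.rpow_natCast ((n : ℝ) ^ _) 2, ← Real.rpow_mul hn0.le, mul_left_comm,
      ← Real.rpow_add hn0]
    refine mul_le_mul_of_nonneg_left (Real.rpow_le_rpow_of_exponent_le
      (by exact_mod_cast one_le (a := n)) ?_) (sq_nonneg D)
    push_cast; linarith
  have h4 := mul_le_mul_of_nonneg_left h1 (by positivity : 0 ≤ (n : ℝ) ^ (4 * r'))
  nlinarith

/-- Young's inequality for `|a| = (n^(2ρ) |a|) * n^(-2ρ)`. Summed over `n` with `ρ > 1/4`, it embeds
`H_ρ` in `L^∞`. -/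
theorem abs_le_rpow_mul_sq_add (n : ℕ+) (ρ a : ℝ) :
    |a| ≤ (n : ℝ) ^ (4 * ρ) * a ^ 2 + (n : ℝ) ^ (-4 * ρ) := by
  have hn0 : (0 : ℝ) < n := by exact_mod_cast n.pos
  have h1 : (n : ℝ) ^ (2 * ρ) * (n : ℝ) ^ (-2 * ρ) = 1 := by
    rw [← Real.rpow_add hn0]; simp
  have h2 : (n : ℝ) ^ (-4 * ρ) = ((n : ℝ) ^ (-2 * ρ)) ^ 2 := by
    have := rpow_mul_sq n (-ρ)
    rw [show 2 * -ρ = -2 * ρ by ring, show 4 * -ρ = -4 * ρ by ring] at this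
    exact this.symm
  rw [h2, ← rpow_mul_sq, ← sq_abs a]
  set u := (n : ℝ) ^ (2 * ρ)
  set v := (n : ℝ) ^ (-2 * ρ)
  have h3 : u * |a| * v = |a| := by rw [mul_right_comm, h1, one_mul]
  nlinarith [sq_nonneg (u * |a| - v), sq_nonneg (u * |a|), sq_nonneg v]

/-- Solutions in coordinates are bounded in `H_ι`, uniformly in the projection. -/
theorem exists_forall_sum_rpow_mul_sq_le {α : Type*} {c₀ c₁ T ι ρ : ℝ} (hc₀ : 0 < c₀)
    (hι₀ : 0 ≤ ι) (hι₁ : ι < 1) (hρ : 1 / 4 < ρ) (hιρ : ι ≤ ρ) {J : α → Finset ℕ+} {ξ : ℕ+ → ℝ}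
    (hξ : Summable fun n : ℕ+ => (n : ℝ) ^ (4 * ι) * ξ n ^ 2) {o x : α → ℝ → ℕ+ → ℝ}
    (hx : ∀ a, IsMildSolution c₀ c₁ T (J a) ξ (o a) (x a)) {Ω : ℝ}
    (ho : ∀ a, ∀ t ∈ Icc 0 T, ∑ n ∈ J a, (n : ℝ) ^ (4 * ρ) * o a t n ^ 2 ≤ Ω) :
    ∃ M, ∀ a, ∀ t ∈ Icc 0 T, ∑ n ∈ J a, (n : ℝ) ^ (4 * ι) * x a t n ^ 2 ≤ M := by
  have hmono : ∀ (a : α) (y : ℕ+ → ℝ) (r r' : ℝ), r ≤ r' →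
      ∑ n ∈ J a, (n : ℝ) ^ (4 * r) * y n ^ 2 ≤ ∑ n ∈ J a, (n : ℝ) ^ (4 * r') * y n ^ 2 :=
    fun a y r r' hr => Finset.sum_le_sum fun n _ => mul_le_mul_of_nonneg_right
      (Real.rpow_le_rpow_of_exponent_le (by exact_mod_cast one_le (a := n)) (by linarith)) (sq_nonneg _)
  have hξ' : ∀ (a : α) (r : ℝ), r ≤ ι → ∑ n ∈ J a, (n : ℝ) ^ (4 * r) * ξ n ^ 2 ≤
      ∑' n : ℕ+, (n : ℝ) ^ (4 * ι) * ξ n ^ 2 := fun a r hr => (hmono a ξ r ι hr).trans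
    (hξ.sum_le_tsum _ fun n _ => by positivity)
  set Ξ := ∑' n : ℕ+, (n : ℝ) ^ (4 * ι) * ξ n ^ 2
  have ho' : ∀ (a : α) (r : ℝ), r ≤ ι → ∀ t ∈ Icc 0 T,
      ∑ n ∈ J a, (n : ℝ) ^ (4 * r) * o a t n ^ 2 ≤ Ω := fun a r hr t ht =>
    (hmono a _ r ρ (hr.trans hιρ)).trans (ho a t ht)
  have hsum := summable_pnat_rpow (show -4 * ρ < -1 by linarith)
  have hK : ∀ a, ∀ t ∈ Icc 0 T, ∀ u, |sinePoly (J a) (o a t) u| ≤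
      √2 * (Ω + ∑' n : ℕ+, (n : ℝ) ^ (-4 * ρ)) := fun a t ht u => by
    refine (abs_sinePoly_le _ _ _).trans (mul_le_mul_of_nonneg_left ?_ (Real.sqrt_nonneg 2))
    refine (Finset.sum_le_sum fun n _ => abs_le_rpow_mul_sq_add n ρ (o a t n)).trans ?_
    rw [Finset.sum_add_distrib]
    exact add_le_add (ho a t ht) (hsum.sum_le_tsum _ fun n _ => by positivity)
  set K := √2 * (Ω + ∑' n : ℕ+, (n : ℝ) ^ (-4 * ρ))
  -- The case `k = 0` is the energy bound. Capping the exponent at `ι` keeps `ξ` and `o` controlled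
  -- in every round.
  have hstep : ∀ k : ℕ, ∃ M, ∀ a, ∀ t ∈ Icc 0 T,
      ∑ n ∈ J a, (n : ℝ) ^ (4 * min ι (k / 5)) * x a t n ^ 2 ≤ M := by
    intro k
    induction k with
    | zero =>
      refine ⟨2 * (Real.exp (T * (c₁ ^ 2 / c₀ * K ^ 2)) * (Ξ + K ^ 2) + Ω), fun a t ht => ?_⟩
      have h0 : ∀ y : ℕ+ → ℝ, ∑ n ∈ J a, (n : ℝ) ^ (4 * (0 : ℝ)) * y n ^ 2 =
          ∑ n ∈ J a, y n ^ 2 := fun y => by simp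
      have hmin : min ι (((0 : ℕ) : ℝ) / 5) = 0 := by simp [hι₀]
      rw [hmin, h0]
      have h1 := (hx a).sum_sub_sq_le hc₀ (hK a) ht
      have h2 := hξ' a 0 hι₀
      have h3 := ho' a 0 hι₀ t ht
      rw [h0] at h2 h3
      have h4 : ∑ n ∈ J a, x a t n ^ 2 ≤
          2 * (∑ n ∈ J a, (x a t n - o a t n) ^ 2 + ∑ n ∈ J a, o a t n ^ 2) := by
        rw [← Finset.sum_add_distrib, Finset.mul_sum]
        exact Finset.sum_le_sum fun n _ => by nlinarith [sq_nonneg (x a t n - 2 * o a t n)]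
      have h5 := mul_le_mul_of_nonneg_left (add_le_add_left h2 (K ^ 2))
        (Real.exp_pos (T * (c₁ ^ 2 / c₀ * K ^ 2))).le
      linarith
    | succ k ih =>
      obtain ⟨M, hM⟩ := ih
      set r := min ι ((k : ℝ) / 5) with hr
      set r' := min ι (((k + 1 : ℕ) : ℝ) / 5) with hr'
      have hr0 : 0 ≤ r := le_min hι₀ (by positivity)
      have hr1 : r ≤ 1 := (min_le_left _ _).trans hι₁.le
      have hrr : r' ≤ r + 1 / 5 := by
        rw [hr, ← min_add_add_right]
        refine min_le_min (by linarith) (le_of_eq ?_)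
        push_cast; ring
      have hr'ι : r' ≤ ι := min_le_left _ _
      have h65 := summable_pnat_rpow (show (-(6 / 5) : ℝ) < -1 by norm_num)
      set D := 12 * |c₁| * M / (c₀ * Real.pi)
      refine ⟨3 * (Ξ + Ω + D ^ 2 * ∑' n : ℕ+, (n : ℝ) ^ (-(6 / 5) : ℝ)), fun a t ht => ?_⟩
      refine (Finset.sum_le_sum fun n hn =>
        rpow_mul_sq_le hrr ((hx a).abs_le hc₀ hr0 hr1 (hM a) ht hn)).trans ?_
      rw [← Finset.mul_sum, Finset.sum_add_distrib, Finset.sum_add_distrib, ← Finset.mul_sum]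
      have h1 := hξ' a r' hr'ι
      have h2 := ho' a r' hr'ι t ht
      have h3 := mul_le_mul_of_nonneg_left
        (h65.sum_le_tsum (J a) fun n _ => by positivity) (sq_nonneg D)
      linarith
  -- Five steps of `1/5` reach `1`, which exceeds `ι`.
  obtain ⟨M, hM⟩ := hstep 5
  refine ⟨M, fun a t ht => ?_⟩
  have := hM a t ht
  rwa [show min ι (((5 : ℕ) : ℝ) / 5) = ι by norm_num; exact hι₁.le] at this

/-! ### From the Hilbert space to coordinates -/

theorem integral_lam (f : ℝ → ℝ) : ∫ t, f t ∂lam = ∫ t in (0 : ℝ)..1, f t := by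
  rw [intervalIntegral.integral_of_le zero_le_one, integral_Ioc_eq_integral_Ioo]

theorem memLp_lam_of_continuous {f : ℝ → ℝ} (hf : Continuous f) : MemLp f 2 lam := by
  obtain ⟨C, hC⟩ := isCompact_Icc.exists_bound_of_continuousOn (s := Icc (0 : ℝ) 1)
    hf.continuousOn
  refine MemLp.of_bound hf.aestronglyMeasurable C ?_
  filter_upwards [ae_restrict_mem measurableSet_Ioo] with t ht
  exact hC t (Ioo_subset_Icc_self ht)

theorem coeFn_e (n : ℕ+) : e n =ᵐ[lam] sine n := (memLp_sine n).coeFn_toLp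

theorem coeFn_sum_smul_e (J : Finset ℕ+) (x : ℕ+ → ℝ) :
    (∑ n ∈ J, x n • e n : H) =ᵐ[lam] sinePoly J x := by
  classical
  induction J using Finset.induction_on with
  | empty =>
    filter_upwards [Lp.coeFn_zero ℝ 2 lam] with t ht
    simpa [sinePoly] using ht
  | insert n J hn ih =>
    rw [Finset.sum_insert hn]
    filter_upwards [Lp.coeFn_add (x n • e n) (∑ n ∈ J, x n • e n), Lp.coeFn_smul (x n) (e n),
      coeFn_e n, ih] with t h1 h2 h3 h4
    rw [h1, Pi.add_apply, h2, Pi.smul_apply, h3, h4, sinePoly, sinePoly, Finset.sum_insert hn,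
      smul_eq_mul]

theorem inner_e_eq_integral {v : H} {f : ℝ → ℝ} (h : v =ᵐ[lam] f) (n : ℕ+) :
    inner ℝ (e n) v = ∫ t in (0 : ℝ)..1, sine n t * f t := by
  rw [L2.inner_def, ← integral_lam]
  refine integral_congr_ae ?_
  filter_upwards [coeFn_e n, h] with t h1 h2
  rw [h1, h2]
  simp [mul_comm]

theorem inner_e_e (n m : ℕ+) : inner ℝ (e n) (e m) = if n = m then (1 : ℝ) else 0 := by
  rw [inner_e_eq_integral (coeFn_e m), integral_sine_mul_sine]

theorem orthonormal_e : Orthonormal ℝ e := orthonormal_iff_ite.2 inner_e_e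

theorem isWeakDeriv_of_ae_eq {v g : H} {J : Finset ℕ+} {x : ℕ+ → ℝ}
    (hv : v =ᵐ[lam] sinePoly J x) (hg : g =ᵐ[lam] sinePolyDeriv J x) : IsWeakDeriv v g := by
  intro φ hφ _ hs
  have h1 : ∫ t, g t * φ t ∂lam = ∫ t in (0 : ℝ)..1, sinePolyDeriv J x t * φ t := by
    rw [← integral_lam]
    exact integral_congr_ae (by filter_upwards [hg] with t ht using by rw [ht])
  have h2 : ∫ t, v t * deriv φ t ∂lam = ∫ t in (0 : ℝ)..1, sinePoly J x t * deriv φ t := by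
    rw [← integral_lam]
    exact integral_congr_ae (by filter_upwards [hv] with t ht using by rw [ht])
  have hd : ∀ t ∈ uIcc (0 : ℝ) 1, HasDerivAt φ (deriv φ t) t := fun t _ =>
    (hφ.differentiable (by simp)).differentiableAt.hasDerivAt
  have h := intervalIntegral.integral_mul_deriv_eq_deriv_mul
    (fun t _ => hasDerivAt_sinePoly J x t) hd
    (Continuous.intervalIntegrable (by fun_prop) _ _)
    ((hφ.continuous_deriv (by simp)).intervalIntegrable _ _)
  rw [h1, h2, h]
  -- The boundary terms vanish because sine polynomials are zero at both endpoints.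
  simp

/-- The fundamental lemma of the calculus of variations. It identifies the derivative chosen in
`weakDeriv` with the classical one. -/
theorem IsWeakDeriv.unique {v g₁ g₂ : H} (h₁ : IsWeakDeriv v g₁) (h₂ : IsWeakDeriv v g₂) :
    g₁ = g₂ := by
  have hi : ∀ g : H, Integrable g lam := fun g => (Lp.memLp g).integrable one_le_two
  have h := isOpen_Ioo.ae_eq_zero_of_integral_contDiff_smul_eq_zero (U := Ioo (0 : ℝ) 1)
    (μ := lam) (f := fun t => g₁ t - g₂ t)
    (((hi g₁).sub (hi g₂)).locallyIntegrable.locallyIntegrableOn _) ?_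
  · refine Lp.ext ?_
    filter_upwards [h, ae_restrict_mem measurableSet_Ioo] with t ht htI
    exact sub_eq_zero.1 (ht htI)
  · intro φ hφ hc hs
    obtain ⟨C, hC⟩ := hφ.continuous.bounded_above_of_compact_support hc
    have hm : ∀ g : H, Integrable (fun t => g t * φ t) lam := fun g =>
      (hi g).mul_bdd hφ.continuous.aestronglyMeasurable (Filter.Eventually.of_forall hC)
    have : ∀ t, φ t • (g₁ t - g₂ t) = g₁ t * φ t - g₂ t * φ t := fun t => by
      rw [smul_eq_mul]; ring
    simp_rw [this]
    rw [integral_sub (hm g₁) (hm g₂), h₁ φ hφ hc hs, h₂ φ hφ hc hs, sub_self]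

theorem coeFn_weakDeriv {v : H} {J : Finset ℕ+} {x : ℕ+ → ℝ} (hv : v =ᵐ[lam] sinePoly J x) :
    weakDeriv v =ᵐ[lam] sinePolyDeriv J x := by
  have hm := memLp_lam_of_continuous (continuous_sinePolyDeriv J x)
  have hw := isWeakDeriv_of_ae_eq hv hm.coeFn_toLp
  have hex : ∃ g, IsWeakDeriv v g := ⟨_, hw⟩
  rw [weakDeriv, dif_pos hex, hex.choose_spec.unique hw]
  exact hm.coeFn_toLp

/-- For a sine polynomial the product is almost everywhere a continuous function, hence in `L²`, so
the default value `0` of `nonlinearity` does not occur. -/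
theorem inner_e_nonlinearity {v : H} {J : Finset ℕ+} {x : ℕ+ → ℝ}
    (hv : v =ᵐ[lam] sinePoly J x) (c₁ : ℝ) (n : ℕ+) :
    inner ℝ (e n) (nonlinearity c₁ v) = c₁ * burgersCoeff J x n := by
  have hae : (fun t => c₁ * (v t * weakDeriv v t)) =ᵐ[lam]
      fun t => c₁ * (sinePoly J x t * sinePolyDeriv J x t) := by
    filter_upwards [hv, coeFn_weakDeriv hv] with t h1 h2
    rw [h1, h2]
  have hm : MemLp (fun t => c₁ * (v t * weakDeriv v t)) 2 lam :=
    (memLp_congr_ae hae).2 (memLp_lam_of_continuous (by fun_prop))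
  rw [nonlinearity, dif_pos hm, inner_e_eq_integral (hm.coeFn_toLp.trans hae), burgersCoeff,
    ← intervalIntegral.integral_const_mul]
  exact intervalIntegral.integral_congr fun t _ => by ring

/-- The coordinates of `v` with respect to the basis `e`. -/
def coord (v : H) (n : ℕ+) : ℝ := inner ℝ (e n) v

theorem continuous_coord : Continuous coord :=
  continuous_pi fun _ => continuous_const.inner continuous_id

open Classical in
/-- The set of those indices `n` with `e n ∈ I`. -/
def indexSet (I : Finset basisSet) : Finset ℕ+ := I.image fun h => h.2.choose

theorem sum_eq_sum_indexSet (I : Finset basisSet) (f : H → H) :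
    ∑ h ∈ I, f h = ∑ n ∈ indexSet I, f (e n) := by
  classical
  have he : ∀ h : basisSet, e h.2.choose = h := fun h => h.2.choose_spec
  rw [indexSet, Finset.sum_image fun a _ b _ hab => by
    rw [Subtype.ext_iff, ← he a, ← he b]; exact congrArg e hab]
  exact Finset.sum_congr rfl fun h _ => by rw [he]

theorem proj_eq_sum (I : Finset basisSet) (v : H) :
    proj I v = ∑ n ∈ indexSet I, coord v n • e n := by
  rw [proj_apply]
  exact sum_eq_sum_indexSet I fun h => inner ℝ h v • h

theorem coord_sum_smul_e (J : Finset ℕ+) (x : ℕ+ → ℝ) (n : ℕ+) :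
    coord (∑ m ∈ J, x m • e m) n = if n ∈ J then x n else 0 := by
  simp [coord, inner_sum, inner_smul_right, inner_e_e]

theorem coord_proj (I : Finset basisSet) (v : H) (n : ℕ+) :
    coord (proj I v) n = if n ∈ indexSet I then coord v n else 0 := by
  rw [proj_eq_sum, coord_sum_smul_e]

theorem coord_eq_zero_of_mem_range {I : Finset basisSet} {v : H} (hv : v ∈ range (proj I))
    {n : ℕ+} (hn : n ∉ indexSet I) : coord v n = 0 := by
  obtain ⟨w, rfl⟩ := hv
  rw [coord_proj, if_neg hn]

theorem eq_sum_of_mem_range {I : Finset basisSet} {v : H} (hv : v ∈ range (proj I)) :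
    v = ∑ n ∈ indexSet I, coord v n • e n := by
  obtain ⟨w, rfl⟩ := hv
  rw [proj_eq_sum I w]
  exact Finset.sum_congr rfl fun n hn => by rw [coord_sum_smul_e, if_pos hn]

/-- On the range of `proj I` the series has finite support, so no convergence question arises for
any `f`. -/
theorem spectralApply_of_mem_range (c₀ : ℝ) (f : ℝ → ℝ) {I : Finset basisSet} {v : H}
    (hv : v ∈ range (proj I)) :
    spectralApply c₀ f v = ∑ n ∈ indexSet I, (f (eigenvalue c₀ n) * coord v n) • e n :=
  tsum_eq_sum fun n hn => by
    have := coord_eq_zero_of_mem_range hv hn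
    rw [coord] at this
    rw [this, mul_zero, zero_smul]

theorem neg_eigenvalue_rpow_mul_sq {c₀ : ℝ} (hc₀ : 0 < c₀) (r a : ℝ) (n : ℕ+) :
    ((-eigenvalue c₀ n) ^ r * a) ^ 2 =
      ((c₀ * Real.pi ^ 2) ^ r) ^ 2 * ((n : ℝ) ^ (4 * r) * a ^ 2) := by
  have hn : (0 : ℝ) ≤ n := by positivity
  have h1 : -eigenvalue c₀ n = c₀ * Real.pi ^ 2 * (n : ℝ) ^ 2 := by rw [eigenvalue]; ring
  rw [h1, Real.mul_rpow (by positivity) (by positivity), ← rpow_mul_sq, ← Real.rpow_natCast_mul hn]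
  push_cast; ring

theorem interpNorm_sq_of_mem_range {c₀ : ℝ} (hc₀ : 0 < c₀) (r : ℝ) {I : Finset basisSet} {v : H}
    (hv : v ∈ range (proj I)) :
    interpNorm c₀ r v ^ 2 = ((c₀ * Real.pi ^ 2) ^ r) ^ 2 *
      ∑ n ∈ indexSet I, (n : ℝ) ^ (4 * r) * coord v n ^ 2 := by
  rw [interpNorm, spectralApply_of_mem_range c₀ _ hv, ← real_inner_self_eq_norm_sq,
    orthonormal_e.inner_sum, Finset.mul_sum]
  refine Finset.sum_congr rfl fun n _ => ?_
  rw [← neg_eigenvalue_rpow_mul_sq hc₀, sq]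
  simp

theorem mem_interpSpace_of_mem_range (c₀ r : ℝ) {I : Finset basisSet} {v : H}
    (hv : v ∈ range (proj I)) : v ∈ interpSpace c₀ r :=
  summable_of_ne_finset_zero (s := indexSet I) fun n hn => by
    have := coord_eq_zero_of_mem_range hv hn
    rw [coord] at this
    simp [this]

theorem isMildSolution_coord {c₀ c₁ T : ℝ} {I : Finset basisSet} {ξ : H} {O X : ℝ → H}
    (hX_cont : ContinuousOn X (Icc 0 T)) (hX_range : ∀ t ∈ Icc 0 T, X t ∈ range (proj I))
    (hX : ∀ t ∈ Icc 0 T, X t = semigroup c₀ t (proj I ξ)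
      + (∫ s in (0 : ℝ)..t, semigroup c₀ (t - s) (proj I (nonlinearity c₁ (X s)))) + O t) :
    IsMildSolution c₀ c₁ T (indexSet I) (coord ξ) (fun t => coord (O t))
      (fun t => coord (X t)) where
  continuousOn := continuous_coord.comp_continuousOn hX_cont
  eq t ht n hn := by
    set J := indexSet I
    have hsemi : ∀ (t : ℝ) (v : H), semigroup c₀ t (proj I v) =
        ∑ n ∈ J, (Real.exp (t * eigenvalue c₀ n) * coord v n) • e n := fun t v => by
      rw [semigroup, spectralApply_of_mem_range c₀ _ ⟨v, rfl⟩]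
      exact Finset.sum_congr rfl fun n hn => by rw [coord_proj, if_pos hn]
    have hG : ∀ s ∈ Icc 0 t, semigroup c₀ (t - s) (proj I (nonlinearity c₁ (X s))) =
        ∑ n ∈ J, (Real.exp ((t - s) * eigenvalue c₀ n) *
          (c₁ * burgersCoeff J (coord (X s)) n)) • e n := fun s hs => by
      rw [hsemi]
      refine Finset.sum_congr rfl fun n _ => ?_
      have hXs := eq_sum_of_mem_range (hX_range s ⟨hs.1, hs.2.trans ht.2⟩)
      have hae := coeFn_sum_smul_e J (coord (X s))
      rw [← hXs] at hae
      rw [← inner_e_nonlinearity hae]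
      rfl
    -- The integrand is a finite sum of continuous terms. The resulting integrability lets the inner
    -- product with `e n` pass under the integral.
    have hGc : ContinuousOn (fun s => semigroup c₀ (t - s) (proj I (nonlinearity c₁ (X s))))
        (Icc 0 t) := by
      refine ContinuousOn.congr (continuousOn_finsetSum _ fun n _ => ?_) hG
      have hexp : Continuous fun s => Real.exp ((t - s) * eigenvalue c₀ n) := by fun_prop
      refine (hexp.continuousOn.mul (continuousOn_const.mul ?_)).smul continuousOn_const
      exact ((continuous_burgersCoeff J n).comp continuous_coord).comp_continuousOn
        (hX_cont.mono (Icc_subset_Icc_right ht.2))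
    have hint : IntervalIntegrable
        (fun s => semigroup c₀ (t - s) (proj I (nonlinearity c₁ (X s)))) volume 0 t :=
      ContinuousOn.intervalIntegrable (by rwa [uIcc_of_le ht.1])
    have hadd : ∀ v w : H, coord (v + w) n = coord v n + coord w n := fun v w =>
      inner_add_right _ _ _
    change coord (X t) n = _
    rw [hX t ht, hadd, hadd, hsemi, coord_sum_smul_e, if_pos hn]
    congr 2
    have hcomm := (innerSL ℝ (e n)).intervalIntegral_comp_comm hint
    simp only [innerSL_apply_apply] at hcomm
    rw [coord, ← hcomm]
    refine intervalIntegral.integral_congr fun s hs => ?_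
    rw [uIcc_of_le ht.1] at hs
    change coord (semigroup c₀ (t - s) (proj I (nonlinearity c₁ (X s)))) n = _
    rw [hG s hs, coord_sum_smul_e, if_pos hn]

end Burgers

end

/-! ### The theorem -/

theorem mainTheorem5 (c₀ c₁ T ι γ : ℝ) (hc₀ : 0 < c₀) (hT : 0 < T)
    (hι₀ : 0 ≤ ι) (hι₁ : ι < 1) (hγ : 1 / 4 < γ)
    (ξ : Burgers.H) (hξ : ξ ∈ Burgers.interpSpace c₀ ι)
    (O X : Finset Burgers.basisSet → ℝ → Burgers.H)
    (hO_cont : ∀ I, ContinuousOn (O I) (Set.Icc 0 T))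
    (hO_range : ∀ I, ∀ t ∈ Set.Icc 0 T, O I t ∈ Set.range (Burgers.proj I))
    (hO_bdd : ∃ C : ℝ, ∀ I, ∀ t ∈ Set.Icc 0 T, Burgers.interpNorm c₀ (max γ ι) (O I t) ≤ C)
    (hX_cont : ∀ I, ContinuousOn (X I) (Set.Icc 0 T))
    (hX_range : ∀ I, ∀ t ∈ Set.Icc 0 T, X I t ∈ Set.range (Burgers.proj I))
    (hX : ∀ I, ∀ t ∈ Set.Icc 0 T,
      X I t = Burgers.semigroup c₀ t (Burgers.proj I ξ)
        + (∫ s in (0 : ℝ)..t,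
            Burgers.semigroup c₀ (t - s) (Burgers.proj I (Burgers.nonlinearity c₁ (X I s))))
        + O I t) :
    ∃ C : ℝ, ∀ I, ∀ t ∈ Set.Icc 0 T,
      X I t ∈ Burgers.interpSpace c₀ ι ∧ Burgers.interpNorm c₀ ι (X I t) ≤ C := by
  have hκ : ∀ r : ℝ, 0 < ((c₀ * Real.pi ^ 2) ^ r) ^ 2 := fun r => by
    have := Real.pi_pos
    positivity
  obtain ⟨C, hC⟩ := hO_bdd
  have ho : ∀ I, ∀ t ∈ Set.Icc 0 T,
      ∑ n ∈ Burgers.indexSet I, (n : ℝ) ^ (4 * max γ ι) * Burgers.coord (O I t) n ^ 2 ≤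
        C ^ 2 / ((c₀ * Real.pi ^ 2) ^ max γ ι) ^ 2 := fun I t ht => by
    rw [le_div_iff₀' (hκ _), ← Burgers.interpNorm_sq_of_mem_range hc₀ _ (hO_range I t ht)]
    exact pow_le_pow_left₀ (norm_nonneg _) (hC I t ht) 2
  have hξ' : Summable fun n : ℕ+ => (n : ℝ) ^ (4 * ι) * Burgers.coord ξ n ^ 2 := by
    have h : Summable fun n : ℕ+ => |(-Burgers.eigenvalue c₀ n) ^ ι * Burgers.coord ξ n| ^ 2 := hξ
    simp_rw [sq_abs, Burgers.neg_eigenvalue_rpow_mul_sq hc₀] at h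
    exact (summable_mul_left_iff (hκ ι).ne').1 h
  -- Here `ρ = max γ ι`: exceeding `1/4` it gives the sup bound on `O`, and being at least `ι` it
  -- controls `O` in `H_ι`.
  obtain ⟨M, hM⟩ := Burgers.exists_forall_sum_rpow_mul_sq_le (c₁ := c₁) hc₀ hι₀ hι₁
    (hγ.trans_le (le_max_left γ ι)) (le_max_right γ ι) hξ'
    (fun I => Burgers.isMildSolution_coord (hX_cont I) (hX_range I) (hX I)) ho
  refine ⟨√(((c₀ * Real.pi ^ 2) ^ ι) ^ 2 * M), fun I t ht =>
    ⟨Burgers.mem_interpSpace_of_mem_range c₀ ι (hX_range I t ht), Real.le_sqrt_of_sq_le ?_⟩⟩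
  rw [Burgers.interpNorm_sq_of_mem_range hc₀ ι (hX_range I t ht)]
  exact mul_le_mul_of_nonneg_left (hM I t ht) (hκ ι).le
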